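/- Let $\{0,1\}^{\mathbb N}$ be Cantor space. Fix a computable bijective coding $\langle\cdot,\cdot\rangle$ of pairs of numbers and an injective computable coding of finite binary words by numbers. A name of an open set $U\subseteq\{0,1\}^{\mathbb N}$ is an $r\in\{0,1\}^{\mathbb N}$ such that $U$ is the union of the cylinders $[w]$ over all words $w$ with $r(\langle w,t\rangle)=1$ for some $t\in\mathbb N$ (so $r$ enumerates words whose cylinders exhaust $U$). A name of a $\Delta^0_2$ set $D$ is a sequence of names of open sets $V_0,U_0,V_1,U_1,\dots$, coded as one element of $\{0,1\}^{\mathbb N}$, such that, with the closed sets $A_i:=\{0,1\}^{\mathbb N}\setminus V_i$, $D=\bigcup_{i\in\mathbb N}A_i=\bigcap_{i\in\mathbb N}U_i$. A set is computably open (computably $\Delta^0_2$) if it has a computable name, and the number of a program that computes such a name is an index of the set. A function $f:\{0,1\}^{\mathbb N}\to\{0,1\}^{\mathbb N}$ is called - *Markov-effectively $\Delta^0_2$-measurable* if there is a partial computable function $P:\subseteq\mathbb N\to\mathbb N$ such that, whenever $n$ is an index of a computably open set $U$, $P(n)$ is defined and is an index of $f^{-1}(U)$ as a computably $\Delta^0_2$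 set; - *effectively $\Delta^0_2$-measurable* if some (type-2) computable map sends every name of an arbitrary open set $U$ to a name of the $\Delta^0_2$ set $f^{-1}(U)$; - *piecewise continuous* if $\{0,1\}^{\mathbb N}$ is covered by countably many closed sets such that the restriction of $f$ to each of them is continuous. Then: (1) there is a Markov-effectively $\Delta^0_2$-measurable function $f:\{0,1\}^{\mathbb N}\to\{0,1\}^{\mathbb N}$ that is not piecewise continuous; (2) Markov-effective $\Delta^0_2$-measurability does not imply effective $\Delta^0_2$-measurability, i.e. there is a Markov-effectively $\Delta^0_2$-measurable function $f:\{0,1\}^{\mathbb N}\to\{0,1\}^{\mathbb N}$ that is not effectively $\Delta^0_2$-measurable. -/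

import Mathlib

namespace Delta2

/-- Cantor space `{0,1}^ℕ`, with the product topology. Its points also serve as names. -/
abbrev Cantor : Type := ℕ → Bool

/-- The prefix of length `n` of `p`. -/
def pre (p : Cantor) (n : ℕ) : List Bool := (List.range n).map p

/-- The open set named by `r`: the union of the cylinders `[w]` over all words `w` listed by `r`,
where `r` lists `w` if `r ⟨w, t⟩ = 1` for some `t`. Every `r` is a name. -/
def openOf (r : Cantor) : Set Cantor :=
  {p | ∃ n t : ℕ, r (Nat.pair (Encodable.encode (pre p n)) t) = true}

/-- The `k`-th component of the sequence of names coded by `s`. -/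
def row (s : Cantor) (k : ℕ) : Cantor := fun j => s (Nat.pair k j)

/-- `s` is a name of the `Δ⁰₂` set `D`: it codes a sequence `(A i, U i)` of closed sets `A i`
(given by names of their complements) and open sets `U i` with `D = ⋃ i, A i = ⋂ i, U i`. -/
def IsDelta2Name (s : Cantor) (D : Set Cantor) : Prop :=
  D = ⋃ i : ℕ, (openOf (row s (2 * i)))ᶜ ∧ D = ⋂ i : ℕ, openOf (row s (2 * i + 1))

/-- The `n`-th partial computable function is total and computes the name `r`. -/
def IsNameIndex (n : ℕ) (r : Cantor) : Prop :=
  ∀ k : ℕ, Encodable.encode (r k) ∈ (Denumerable.ofNat Nat.Partrec.Code n).eval k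

/-- The partial enumeration of the computably open sets: `n` is an index of `U`. -/
def IsOpenIndex (n : ℕ) (U : Set Cantor) : Prop :=
  ∃ r : Cantor, IsNameIndex n r ∧ openOf r = U

/-- The partial enumeration of the computably `Δ⁰₂` sets: `n` is an index of `D`. -/
def IsDelta2Index (n : ℕ) (D : Set Cantor) : Prop :=
  ∃ s : Cantor, IsNameIndex n s ∧ IsDelta2Name s D

/-- `f` is Markov-effectively `Δ⁰₂`-measurable: a partial computable function on indices turns
every index of a computably open set `U` into an index of the `Δ⁰₂` set `f⁻¹(U)`. -/
def MarkovEffectivelyDelta2Measurable (f : Cantor → Cantor) : Prop :=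
  ∃ P : ℕ →. ℕ, Nat.Partrec P ∧
    ∀ (n : ℕ) (U : Set Cantor), IsOpenIndex n U → ∃ m ∈ P n, IsDelta2Index m (f ⁻¹' U)

/-- A total function on Cantor space is (type-2) computable if its finite output prefixes are
produced, from finite input prefixes, by a computable monotone function on words. -/
def Type2Computable (F : Cantor → Cantor) : Prop :=
  ∃ h : List Bool → List Bool, Computable h ∧
    (∀ u v : List Bool, u <+: v → h u <+: h v) ∧
    ∀ p : Cantor,
      (∀ n : ℕ, h (pre p n) = pre (F p) (h (pre p n)).length) ∧
      ∀ m : ℕ, ∃ n : ℕ, m ≤ (h (pre p n)).length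

/-- `f` is effectively `Δ⁰₂`-measurable: `U ↦ f⁻¹(U)`, from open sets to `Δ⁰₂` sets, has a
computable realizer (every point of Cantor space is a name of an open set). -/
def EffectivelyDelta2Measurable (f : Cantor → Cantor) : Prop :=
  ∃ F : Cantor → Cantor, Type2Computable F ∧
    ∀ r : Cantor, IsDelta2Name (F r) (f ⁻¹' openOf r)

/-- `f` is piecewise continuous: the domain has a countable cover by closed sets on each of which
the restriction of `f` is continuous. -/
def PiecewiseContinuous (f : Cantor → Cantor) : Prop :=
  ∃ A : ℕ → Set Cantor, (∀ i, IsClosed (A i)) ∧ (⋃ i, A i) = Set.univ ∧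
    ∀ i, ContinuousOn f (A i)

end Delta2

/- There is a `1`-generic point `y` that is the limit of a computable sequence of points `x c`: as
in the finite extension method, `y` is determined by a sequence of prefixes each of which decides
one more computably open set. The function `f` sends a point with exactly `c` ones to `x c` and a
point with infinitely many ones to `y`.

Since `y` is not on the boundary of a computably open set `U`, membership of `f p` in `U` can be
decided in the limit, uniformly in an index of `U`: at stage `n` count the ones in the first `n`
bits of `p` and ask whether the corresponding `x c` has been seen to be in `U`. This makes `f`
Markov-effectively `Δ⁰₂`-measurable. On the other hand, `y` is not computable and so differs from
every `x c`, whence both the points that `f` sends to `y` and those that it does not are dense. As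
the former contain a dense `Gδ` set, the latter are not `Gδ`, by Baire's theorem. -/

open Filter Topology
open Nat.Partrec (Code)

namespace Delta2

theorem dense_setOf_eventually_eq {X : Type*} [TopologicalSpace X] (a : ℕ → X) :
    Dense {p : ℕ → X | ∀ᶠ k in atTop, p k = a k} := by
  intro p
  let q : ℕ → ℕ → X := fun n k => if k < n then p k else a k
  have hq : Tendsto q atTop (𝓝 p) := tendsto_pi_nhds.2 fun k =>
    tendsto_nhds_of_eventually_eq <| (eventually_gt_atTop k).mono fun n hn => if_pos hn
  exact mem_closure_of_tendsto hq <| .of_forall fun n =>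
    (eventually_ge_atTop n).mono fun k hk => if_neg hk.not_gt

section Prefixes

variable {p q : Cantor}

theorem length_pre (p : Cantor) (n : ℕ) : (pre p n).length = n := by
  simp [pre]

theorem pre_succ (p : Cantor) (n : ℕ) : pre p (n + 1) = pre p n ++ [p n] := by
  simp [pre, List.range_succ]

theorem pre_prefix_pre (p : Cantor) {m n : ℕ} (h : m ≤ n) : pre p m <+: pre p n := by
  obtain ⟨k, rfl⟩ := Nat.exists_eq_add_of_le h
  simp [pre, List.range_add]

theorem take_pre (p : Cantor) {m n : ℕ} (h : m ≤ n) : (pre p n).take m = pre p m := by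
  simp [pre, ← List.map_take, List.take_range, h]

theorem pre_eq_pre_iff {n : ℕ} : pre p n = pre q n ↔ ∀ k < n, p k = q k := by
  simp [pre]

theorem pre_getD_of_prefix {τ w : List Bool} (h : τ <+: w) :
    pre (fun k => w.getD k false) τ.length = τ := by
  refine List.ext_getElem (length_pre _ _) fun k _ hk => ?_
  simp [pre, h.getElem hk, hk.trans_le h.length_le]

theorem nhds_hasBasis_pre_eq (p : Cantor) :
    (𝓝 p).HasBasis (fun _ => True) fun n => {q | pre q n = pre p n} := by
  have hcyl (n : ℕ) : {q | pre q n = pre p n} = PiNat.cylinder p n :=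
    Set.ext fun q => pre_eq_pre_iff.trans PiNat.mem_cylinder_iff.symm
  simp only [hcyl]
  refine ⟨fun U => ?_⟩
  rw [(PiNat.isTopologicalBasis_cylinders _).mem_nhds_iff]
  constructor
  · rintro ⟨_, ⟨a, n, rfl⟩, hp, hU⟩
    exact ⟨n, trivial, PiNat.mem_cylinder_iff_eq.1 hp ▸ hU⟩
  · rintro ⟨n, -, hU⟩
    exact ⟨_, ⟨p, n, rfl⟩, PiNat.self_mem_cylinder p n, hU⟩

theorem eventually_pre_eq (p : Cantor) (n : ℕ) : ∀ᶠ q in 𝓝 p, pre q n = pre p n :=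
  (nhds_hasBasis_pre_eq p).mem_of_mem trivial

theorem computable_pre {α : Type*} [Primcodable α] {x : α → Cantor} (hx : Computable₂ x) :
    Computable₂ fun a n => pre (x a) n := by
  have hstep : Computable₂ fun (a : α × ℕ) (b : ℕ × List Bool) => b.2 ++ [x a.1 b.1] :=
    Computable.list_concat.comp (Computable.snd.comp Computable.snd)
      (hx.comp (Computable.fst.comp Computable.fst) (Computable.fst.comp Computable.snd))
  refine (Computable.nat_rec Computable.snd (Computable.const []) hstep).of_eq fun ⟨a, n⟩ => ?_
  induction n with
  | zero => rfl
  | succ n ih => exact (congrArg (· ++ [x a n]) ih).trans (pre_succ _ _).symm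

end Prefixes

section Names

/-- The word with code number `v`, or the empty word if `v` is not a code. -/
def wordOf (v : ℕ) : List Bool := (Encodable.decode v).getD []

theorem wordOf_encode (w : List Bool) : wordOf (Encodable.encode w) = w := by
  simp [wordOf]

theorem primrec_wordOf : Primrec wordOf :=
  Primrec.option_getD.comp Primrec.decode (Primrec.const [])

/-- The name that lists the words satisfying `g`. -/
def nameOfWords (g : List Bool → Bool) : Cantor := fun j => g (wordOf j.unpair.1)

theorem mem_openOf_nameOfWords {g : List Bool → Bool} {p : Cantor} :
    p ∈ openOf (nameOfWords g) ↔ ∃ n, g (pre p n) = true := by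
  simp [openOf, nameOfWords, wordOf_encode]

theorem computable_nameOfWords {α : Type*} [Primcodable α] {g : α → List Bool → Bool}
    (hg : Computable₂ g) : Computable₂ fun a => nameOfWords (g a) :=
  hg.comp Computable.fst
    (primrec_wordOf.to_comp.comp (Computable.fst.comp (Computable.unpair.comp Computable.snd)))

/-- The sequence of names `u` coded as one point, with `u k` as its `k`-th component. -/
def joinRows (u : ℕ → Cantor) : Cantor := fun j => u j.unpair.1 j.unpair.2

theorem row_joinRows (u : ℕ → Cantor) (k : ℕ) : row (joinRows u) k = u k := by
  funext j
  simp [row, joinRows]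

theorem computable_joinRows {α : Type*} [Primcodable α] {u : α → ℕ → Cantor}
    (hu : Computable₂ fun (a : α × ℕ) j => u a.1 a.2 j) : Computable₂ fun a => joinRows (u a) :=
  have hj : Computable fun a : α × ℕ => a.2.unpair := Computable.unpair.comp Computable.snd
  hu.comp (Computable.fst.pair (Computable.fst.comp hj)) (Computable.snd.comp hj)

theorem isOpen_openOf (r : Cantor) : IsOpen (openOf r) := by
  refine isOpen_iff_mem_nhds.2 fun p ⟨n, t, h⟩ => ?_
  filter_upwards [eventually_pre_eq p n] with q hq
  exact ⟨n, t, by rwa [hq]⟩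

theorem exists_openOf_eq {U : Set Cantor} (hU : IsOpen U) : ∃ r, openOf r = U := by
  classical
  refine ⟨nameOfWords fun w => decide (∀ q, pre q w.length = w → q ∈ U), Set.ext fun p => ?_⟩
  simp only [mem_openOf_nameOfWords, length_pre, decide_eq_true_eq]
  refine ⟨fun ⟨_, hn⟩ => hn p rfl, fun hp => ?_⟩
  obtain ⟨n, -, hn⟩ := (nhds_hasBasis_pre_eq p).mem_iff.1 (hU.mem_nhds hp)
  exact ⟨n, fun q hq => hn hq⟩

theorem exists_computable_isNameIndex {s : ℕ → Cantor} (hs : Computable₂ s) :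
    ∃ P : ℕ → ℕ, Computable P ∧ ∀ e, IsNameIndex (P e) (s e) := by
  have hs' : Computable fun x : ℕ => Encodable.encode (s x.unpair.1 x.unpair.2) :=
    Computable.encode.comp (hs.comp (Computable.fst.comp Computable.unpair)
      (Computable.snd.comp Computable.unpair))
  obtain ⟨c, hc⟩ := Code.exists_code.1 (Partrec.nat_iff.1 hs'.partrec)
  refine ⟨fun e => Encodable.encode (Code.curry c e),
    (Primrec.encode.comp (Code.primrec₂_curry.comp (Primrec.const c) Primrec.id)).to_comp,
    fun e k => ?_⟩
  simp [Code.eval_curry, hc]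

theorem exists_isOpenIndex_compl_singleton {a : Cantor} (ha : Computable a) :
    ∃ e, IsOpenIndex e {a}ᶜ := by
  have hg : Computable₂ fun (_ : ℕ) (w : List Bool) => !decide (w = pre a w.length) :=
    Primrec.not.to_comp.comp (Primrec.eq.decide.to_comp.comp Computable.snd
      ((computable_pre (x := fun _ : ℕ => a) (ha.comp Computable.snd)).comp Computable.fst
        (Computable.list_length.comp Computable.snd)))
  obtain ⟨P, -, hP⟩ := exists_computable_isNameIndex (computable_nameOfWords hg)
  refine ⟨P 0, _, hP 0, Set.ext fun p => ?_⟩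
  simp only [mem_openOf_nameOfWords, length_pre, Bool.not_eq_true', decide_eq_false_iff_not,
    pre_eq_pre_iff, Set.mem_compl_iff, Set.mem_singleton_iff, funext_iff, not_forall]
  exact ⟨fun ⟨_, k, _, h⟩ => ⟨k, h⟩, fun ⟨k, h⟩ => ⟨k + 1, k, k.lt_succ_self, h⟩⟩

end Names

section LimitDecidable

/-- A name of the `Δ⁰₂` set of the points `p` for which `g (pre p n)` is `true` for large `n`,
provided that `g (pre p n)` is eventually constant for every `p`. The words listed at position
`2 * i` and at position `2 * i + 1` are those of length at least `i` where `g` is `false` and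
`true`, respectively. -/
def limitName (g : List Bool → Bool) : Cantor :=
  joinRows fun k => nameOfWords fun w => decide (k.div2 ≤ w.length) && (k.bodd == g w)

theorem mem_openOf_row_limitName_even {g : List Bool → Bool} {p : Cantor} {i : ℕ} :
    p ∈ openOf (row (limitName g) (2 * i)) ↔ ∃ n ≥ i, g (pre p n) = false := by
  simp [limitName, row_joinRows, mem_openOf_nameOfWords, length_pre, Nat.div2_val]

theorem mem_openOf_row_limitName_odd {g : List Bool → Bool} {p : Cantor} {i : ℕ} :
    p ∈ openOf (row (limitName g) (2 * i + 1)) ↔ ∃ n ≥ i, g (pre p n) = true := by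
  simp [limitName, row_joinRows, mem_openOf_nameOfWords, length_pre]

theorem isDelta2Name_limitName {g : List Bool → Bool} {D : Set Cantor}
    (h : ∀ p, ∀ᶠ n in atTop, g (pre p n) = true ↔ p ∈ D) : IsDelta2Name (limitName g) D := by
  constructor
  · ext p
    simp only [Set.mem_iUnion, Set.mem_compl_iff, mem_openOf_row_limitName_even, not_exists,
      not_and, Bool.not_eq_false, ← eventually_atTop]
    exact (eventually_congr (h p)).trans eventually_const |>.symm
  · ext p
    simp only [Set.mem_iInter, mem_openOf_row_limitName_odd, ← frequently_atTop]
    exact (frequently_congr (h p)).trans frequently_const |>.symm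

theorem computable_limitName {α : Type*} [Primcodable α] {g : α → List Bool → Bool}
    (hg : Computable₂ g) : Computable₂ fun a => limitName (g a) := by
  have hlen : Primrec₂ fun (a : α × ℕ) (w : List Bool) => decide (a.2.div2 ≤ w.length) :=
    Primrec.nat_le.decide.comp (Primrec.nat_div2.comp (Primrec.snd.comp Primrec.fst))
      (Primrec.list_length.comp Primrec.snd)
  have hval : Computable₂ fun (a : α × ℕ) (w : List Bool) => a.2.bodd == g a.1 w :=
    Primrec.beq.to_comp.comp (Computable.nat_bodd.comp (Computable.snd.comp Computable.fst))
      (hg.comp (Computable.fst.comp Computable.fst) Computable.snd)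
  have hrow : Computable₂ fun (a : α × ℕ) (w : List Bool) =>
      decide (a.2.div2 ≤ w.length) && (a.2.bodd == g a.1 w) :=
    Primrec.and.to_comp.comp hlen.to_comp hval
  exact computable_joinRows (computable_nameOfWords hrow)

theorem markovEffectivelyDelta2Measurable_of_eventually {f : Cantor → Cantor}
    {g : ℕ → List Bool → Bool} (hg : Computable₂ g)
    (h : ∀ e U, IsOpenIndex e U → ∀ p, ∀ᶠ n in atTop, g e (pre p n) = true ↔ f p ∈ U) :
    MarkovEffectivelyDelta2Measurable f := by
  obtain ⟨P, hP, hidx⟩ := exists_computable_isNameIndex (computable_limitName hg)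
  exact ⟨P, Partrec.nat_iff.1 hP.partrec, fun e U hU =>
    ⟨P e, Part.mem_some _, _, hidx e, isDelta2Name_limitName (h e U hU)⟩⟩

end LimitDecidable

section Enumeration

/-- Within `s` steps, the `e`-th program is seen to list a prefix of the word `w`. -/
def Listed (e s : ℕ) (w : List Bool) : Prop :=
  ∃ m < w.length + 1, ∃ t < s, Code.evaln s (Denumerable.ofNat Code e)
    (Nat.pair (Encodable.encode (w.take m)) t) = some 1

instance (e s : ℕ) (w : List Bool) : Decidable (Listed e s w) := by
  unfold Listed; infer_instance

variable {e : ℕ} {r : Cantor}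

theorem Listed.mono {s t : ℕ} {v w : List Bool} (h : Listed e s v) (hst : s ≤ t)
    (hvw : v <+: w) : Listed e t w := by
  obtain ⟨m, hm, k, hk, h⟩ := h
  obtain ⟨u, rfl⟩ := hvw
  refine ⟨m, by grind, k, hk.trans_le hst, Code.evaln_mono hst ?_⟩
  rwa [List.take_append_of_le_length (Nat.lt_succ_iff.1 hm)]

theorem mem_openOf_iff_exists_listed (h : IsNameIndex e r) {p : Cantor} :
    p ∈ openOf r ↔ ∃ s n, Listed e s (pre p n) := by
  constructor
  · rintro ⟨n, t, hr⟩
    have hval := h (Nat.pair (Encodable.encode (pre p n)) t)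
    rw [hr] at hval
    obtain ⟨s, hs⟩ := Code.evaln_complete.1 hval
    refine ⟨max s (t + 1), n, n, by simp [length_pre], t, by omega, ?_⟩
    rw [take_pre p le_rfl]
    exact Code.evaln_mono (le_max_left _ _) hs
  · rintro ⟨s, n, m, hm, t, -, hs⟩
    rw [length_pre, Nat.lt_succ_iff] at hm
    rw [take_pre p hm] at hs
    refine ⟨m, t, Encodable.encode_injective ?_⟩
    exact Part.mem_unique (h _) (Code.evaln_sound hs)

theorem eventually_listed_iff (h : IsNameIndex e r) {q : ℕ → Cantor} {z : Cantor}
    (hq : Tendsto q atTop (𝓝 z)) (hz : z ∉ openOf r → ∀ᶠ n in atTop, q n ∉ openOf r) :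
    ∀ᶠ n in atTop, Listed e n (pre (q n) n) ↔ z ∈ openOf r := by
  by_cases hmem : z ∈ openOf r
  · obtain ⟨s, m, hs⟩ := (mem_openOf_iff_exists_listed h).1 hmem
    filter_upwards [hq.eventually (eventually_pre_eq z m), eventually_ge_atTop s,
      eventually_ge_atTop m] with n hpre hsn hmn
    rw [← hpre] at hs
    exact iff_of_true (hs.mono hsn (pre_prefix_pre _ hmn)) hmem
  · filter_upwards [hz hmem] with n hn
    exact iff_of_false (fun hl => hn ((mem_openOf_iff_exists_listed h).2 ⟨_, _, hl⟩)) hmem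

theorem primrec_listed :
    Primrec fun a : (ℕ × ℕ) × List Bool => decide (Listed a.1.1 a.1.2 a.2) := by
  have heval : PrimrecRel fun (t : ℕ) (a : ℕ × (ℕ × ℕ) × List Bool) =>
      Code.evaln a.2.1.2 (Denumerable.ofNat Code a.2.1.1)
        (Nat.pair (Encodable.encode (a.2.2.take a.1)) t) = some 1 := by
    have ha : Primrec fun b : ℕ × ℕ × (ℕ × ℕ) × List Bool => b.2.2 :=
      Primrec.snd.comp Primrec.snd
    have htake : Primrec fun b : ℕ × ℕ × (ℕ × ℕ) × List Bool => b.2.2.2.take b.2.1 :=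
      Primrec.list_take.comp (Primrec.fst.comp Primrec.snd) (Primrec.snd.comp ha)
    exact Primrec.eq.comp (Code.primrec_evaln.comp (((Primrec.snd.comp (Primrec.fst.comp ha)).pair
      ((Primrec.ofNat Code).comp (Primrec.fst.comp (Primrec.fst.comp ha)))).pair
        (Primrec₂.natPair.comp (Primrec.encode.comp htake) Primrec.fst))) (Primrec.const _)
  have hstep : PrimrecRel fun (m : ℕ) (a : (ℕ × ℕ) × List Bool) => ∃ t < a.1.2,
      Code.evaln a.1.2 (Denumerable.ofNat Code a.1.1)
        (Nat.pair (Encodable.encode (a.2.take m)) t) = some 1 :=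
    (heval.exists_mem_list.comp (Primrec.list_range.comp (Primrec.snd.comp
      (Primrec.fst.comp Primrec.snd))) Primrec.id).of_eq fun a => by simp
  have hlisted : PrimrecPred fun a : (ℕ × ℕ) × List Bool => Listed a.1.1 a.1.2 a.2 :=
    (hstep.exists_mem_list.comp (Primrec.list_range.comp (Primrec.succ.comp
      (Primrec.list_length.comp Primrec.snd))) Primrec.id).of_eq fun a => by simp [Listed]
  exact hlisted.decide

theorem computable_listed {α : Type*} [Primcodable α] {e s : α → ℕ} {w : α → List Bool}
    (he : Computable e) (hs : Computable s) (hw : Computable w) :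
    Computable fun a => decide (Listed (e a) (s a) (w a)) :=
  primrec_listed.to_comp.comp ((he.pair hs).pair hw)

end Enumeration

section OneGeneric

/-- `y` is `1`-generic: it does not lie on the boundary of any computably open set. -/
def IsOneGeneric (y : Cantor) : Prop := ∀ e U, IsOpenIndex e U → y ∉ frontier U

theorem IsOneGeneric.not_computable {y : Cantor} (hy : IsOneGeneric y) : ¬ Computable y := by
  intro hc
  obtain ⟨e, he⟩ := exists_isOpenIndex_compl_singleton hc
  have hdense : Dense ({y}ᶜ : Set Cantor) := by
    refine (dense_setOf_eventually_eq fun k => !y k).mono ?_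
    rintro p hp rfl
    simpa using hp.exists
  refine hy e _ he ?_
  rw [isOpen_compl_singleton.frontier_eq, hdense.closure_eq]
  simp

/-- The word `τ` decides the `e`-th computably open set: its cylinder is seen to be contained in
the set, or is disjoint from it. -/
def Decides (e : ℕ) (τ : List Bool) : Prop :=
  (∃ s, Listed e s τ) ∨ ∀ s w, τ <+: w → ¬ Listed e s w

theorem Decides.notMem_frontier {e : ℕ} {r y : Cantor} {τ : List Bool} (hτ : Decides e τ)
    (h : IsNameIndex e r) (hy : pre y τ.length = τ) : y ∉ frontier (openOf r) := by
  rcases hτ with ⟨s, hs⟩ | hdisj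
  · rw [← hy] at hs
    rw [(isOpen_openOf r).frontier_eq]
    exact fun hfr => hfr.2 ((mem_openOf_iff_exists_listed h).2 ⟨s, _, hs⟩)
  · suffices ∀ᶠ p in 𝓝 y, p ∉ openOf r from
      fun hfr => mem_closure_iff_frequently.1 (frontier_subset_closure hfr) this
    filter_upwards [eventually_pre_eq y τ.length] with p hp hmem
    obtain ⟨s, n, hs⟩ := (mem_openOf_iff_exists_listed h).1 hmem
    refine hdisj s (pre p (max n τ.length)) ?_ (hs.mono le_rfl (pre_prefix_pre p (le_max_left _ _)))
    conv_lhs => rw [← hy, ← hp]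
    exact pre_prefix_pre p (le_max_right _ _)

/-- An extension of `σ` that the `e`-th program is seen to list within `s` steps, or `σ` itself if
none is found among the extensions by the first `s` words. The search by `findIdx` returns `s` if it
fails, whence the second test. -/
def extendToListed (e s : ℕ) (σ : List Bool) : List Bool :=
  let τ := σ ++ wordOf ((List.range s).findIdx fun v => decide (Listed e s (σ ++ wordOf v)))
  if Listed e s τ then τ else σ

theorem prefix_extendToListed (e s : ℕ) (σ : List Bool) : σ <+: extendToListed e s σ := by
  unfold extendToListed
  grind

theorem eventually_findIdx_range_eq {P : ℕ → ℕ → Bool} (hP : ∀ v, Monotone fun s => P s v)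
    {v : ℕ} (hv : ∃ s, P s v = true) (hmin : ∀ u < v, ∀ s, P s u = false) :
    ∀ᶠ s in atTop, (List.range s).findIdx (P s) = v := by
  obtain ⟨s, hs⟩ := hv
  filter_upwards [eventually_ge_atTop s, eventually_gt_atTop v] with t ht hvt
  rw [List.findIdx_eq (by simpa using hvt)]
  simp only [List.getElem_range]
  exact ⟨by simpa using Bool.eq_true_of_true_le (hs ▸ hP v ht), fun u hu => hmin u hu t⟩

theorem exists_eventually_extendToListed_eq (e : ℕ) (σ : List Bool) :
    ∃ τ, (∀ᶠ s in atTop, extendToListed e s σ = τ) ∧ Decides e τ := by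
  classical
  by_cases h : ∃ v s, Listed e s (σ ++ wordOf v)
  · obtain ⟨s, hs⟩ := Nat.find_spec h
    refine ⟨σ ++ wordOf (Nat.find h), ?_, Or.inl ⟨s, hs⟩⟩
    have hfind := eventually_findIdx_range_eq (P := fun s v => decide (Listed e s (σ ++ wordOf v)))
      (fun v s t hst => by
        simpa [Bool.le_iff_imp] using fun hl : Listed e s _ => hl.mono hst List.prefix_rfl)
      ⟨s, decide_eq_true hs⟩ fun v hv t => decide_eq_false fun ht => Nat.find_min h hv ⟨t, ht⟩
    filter_upwards [hfind, eventually_ge_atTop s] with t ht hst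
    simp only [extendToListed, ht, if_pos (hs.mono hst List.prefix_rfl)]
  · push Not at h
    refine ⟨σ, .of_forall fun s => if_neg (h _ s), Or.inr ?_⟩
    rintro s _ ⟨v, rfl⟩ hl
    exact h (Encodable.encode v) s (by rwa [wordOf_encode])

theorem primrec_extendToListed :
    Primrec fun a : (ℕ × ℕ) × List Bool => extendToListed a.1.1 a.1.2 a.2 := by
  have happ : Primrec₂ fun (a : (ℕ × ℕ) × List Bool) (v : ℕ) => a.2 ++ wordOf v :=
    Primrec.list_append.comp (Primrec.snd.comp Primrec.fst) (primrec_wordOf.comp Primrec.snd)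
  have hext : Primrec fun a : (ℕ × ℕ) × List Bool => a.2 ++ wordOf
      ((List.range a.1.2).findIdx fun v => decide (Listed a.1.1 a.1.2 (a.2 ++ wordOf v))) :=
    happ.comp Primrec.id (Primrec.list_findIdx
      (Primrec.list_range.comp (Primrec.snd.comp Primrec.fst))
      (primrec_listed.comp ((Primrec.fst.comp Primrec.fst).pair happ)))
  exact Primrec.ite ⟨inferInstance, primrec_listed.comp (Primrec.fst.pair hext)⟩ hext Primrec.snd

/-- The stage `s` approximation to a word that decides the first `e` computably open sets. A bit is
appended at each step, so that the length tends to infinity with `e`. -/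
def stem (s : ℕ) : ℕ → List Bool
  | 0 => []
  | e + 1 => extendToListed e s (stem s e) ++ [false]

theorem stem_prefix_stem (s : ℕ) {d e : ℕ} (h : d ≤ e) : stem s d <+: stem s e := by
  induction e, h using Nat.le_induction with
  | base => exact List.prefix_rfl
  | succ e _ ih => exact (ih.trans (prefix_extendToListed e s _)).trans (List.prefix_append _ _)

theorem le_length_stem (s e : ℕ) : e ≤ (stem s e).length := by
  induction e with
  | zero => exact Nat.zero_le _
  | succ e ih => simpa [stem] using ih.trans (prefix_extendToListed e s _).length_le

theorem exists_eventually_stem_eq (e : ℕ) : ∃ σ, ∀ᶠ s in atTop, stem s e = σ := by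
  induction e with
  | zero => exact ⟨[], .of_forall fun _ => rfl⟩
  | succ e ih =>
    obtain ⟨σ, hσ⟩ := ih
    obtain ⟨τ, hτ, -⟩ := exists_eventually_extendToListed_eq e σ
    refine ⟨τ ++ [false], ?_⟩
    filter_upwards [hσ, hτ] with s hs ht
    rw [stem, hs, ht]

theorem primrec_stem : Primrec₂ stem := by
  have hargs : Primrec fun a : ℕ × ℕ × List Bool => ((a.2.1, a.1), a.2.2) :=
    ((Primrec.fst.comp Primrec.snd).pair Primrec.fst).pair (Primrec.snd.comp Primrec.snd)
  have hstep : Primrec₂ fun (s : ℕ) (a : ℕ × List Bool) => extendToListed a.1 s a.2 ++ [false] :=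
    Primrec.list_concat.comp (primrec_extendToListed.comp hargs) (Primrec.const false)
  refine (Primrec.nat_rec (Primrec.const []) hstep).of_eq fun s e => ?_
  induction e with
  | zero => rfl
  | succ e ih => rw [stem, ← ih]

/-- The `n`-th term of a computable sequence that converges to a `1`-generic point. -/
def genericApprox (n : ℕ) : Cantor := fun k => (stem n n).getD k false

theorem computable_genericApprox : Computable₂ genericApprox := by
  have h : Primrec fun a : ℕ × ℕ => ((stem a.1 a.1)[a.2]?).getD false :=
    Primrec.option_getD.comp (Primrec.list_getElem?.comp
      (primrec_stem.comp Primrec.fst Primrec.fst) Primrec.snd) (Primrec.const false)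
  exact h.to_comp.of_eq fun a => by simp [genericApprox]

theorem exists_tendsto_genericApprox : ∃ y, Tendsto genericApprox atTop (𝓝 y) := by
  have hconst (k : ℕ) : ∃ b, ∀ᶠ n in atTop, genericApprox n k = b := by
    obtain ⟨σ, hσ⟩ := exists_eventually_stem_eq (k + 1)
    refine ⟨σ.getD k false, ?_⟩
    filter_upwards [hσ, eventually_ge_atTop (k + 1)] with n hn hkn
    have hpre : σ <+: stem n n := hn ▸ stem_prefix_stem n hkn
    have hk : k < σ.length := hn ▸ le_length_stem n (k + 1)
    simp [genericApprox, hk, hk.trans_le hpre.length_le, hpre.getElem hk]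
  choose y hy using hconst
  exact ⟨y, tendsto_pi_nhds.2 fun k => tendsto_nhds_of_eventually_eq (hy k)⟩

theorem isOneGeneric_of_tendsto_genericApprox {y : Cantor}
    (hy : Tendsto genericApprox atTop (𝓝 y)) : IsOneGeneric y := by
  rintro e _ ⟨r, hr, rfl⟩
  obtain ⟨σ, hσ⟩ := exists_eventually_stem_eq e
  obtain ⟨τ, hτ, hdec⟩ := exists_eventually_extendToListed_eq e σ
  have hstable : ∀ᶠ n in atTop, τ <+: stem n n := by
    filter_upwards [hσ, hτ, eventually_gt_atTop e] with n hn ht hen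
    rw [← ht, ← hn]
    exact (List.prefix_append _ _).trans (stem_prefix_stem n hen)
  obtain ⟨n, hτn, hpre⟩ := (hstable.and (hy.eventually (eventually_pre_eq y τ.length))).exists
  exact hdec.notMem_frontier hr (hpre.symm.trans (pre_getD_of_prefix hτn))

theorem exists_tendsto_isOneGeneric :
    ∃ x : ℕ → Cantor, Computable₂ x ∧ ∃ y, Tendsto x atTop (𝓝 y) ∧ IsOneGeneric y :=
  let ⟨y, hy⟩ := exists_tendsto_genericApprox
  ⟨genericApprox, computable_genericApprox, y, hy, isOneGeneric_of_tendsto_genericApprox hy⟩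

end OneGeneric

section OnesLimit

theorem count_pre (p : Cantor) (n : ℕ) :
    (pre p n).count true = Nat.count (fun k => p k = true) n := by
  simp [pre, List.count, Nat.count, List.countP_map, Function.comp_def]

theorem tendsto_count_pre {p : Cantor} (hp : ∃ᶠ k in atTop, p k = true) :
    Tendsto (fun n => (pre p n).count true) atTop atTop := by
  simp only [count_pre]
  have hsurj := Nat.surjective_count_of_infinite_setOfPred (Nat.frequently_atTop_iff_infinite.1 hp)
  exact tendsto_atTop_atTop_of_monotone (Nat.count_monotone _) fun b =>
    (hsurj b).imp fun _ h => h.ge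

theorem exists_eventually_count_pre_eq {p : Cantor} (hp : ∀ᶠ k in atTop, p k = false) :
    ∃ c, ∀ᶠ n in atTop, (pre p n).count true = c := by
  obtain ⟨N, hN⟩ := eventually_atTop.1 hp
  refine ⟨(pre p N).count true, ?_⟩
  filter_upwards [eventually_ge_atTop N] with n hn
  induction n, hn using Nat.le_induction with
  | base => rfl
  | succ n hn ih => simp [pre_succ, ih, hN n hn]

/-- The limit of the sequence `x`, read along the number of ones in the prefixes of a point: a point
with exactly `c` ones is sent to `x c`, one with infinitely many ones to the limit of `x` (to a junk
value if `x` diverges). -/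
noncomputable def onesLimit (x : ℕ → Cantor) (p : Cantor) : Cantor :=
  limUnder atTop fun n => x ((pre p n).count true)

variable {x : ℕ → Cantor} {y : Cantor}

theorem onesLimit_of_frequently (hx : Tendsto x atTop (𝓝 y)) {p : Cantor}
    (hp : ∃ᶠ k in atTop, p k = true) : onesLimit x p = y :=
  (hx.comp (tendsto_count_pre hp)).limUnder_eq

theorem onesLimit_of_eventually_count_eq {p : Cantor} {c : ℕ}
    (hc : ∀ᶠ n in atTop, (pre p n).count true = c) : onesLimit x p = x c :=
  (tendsto_nhds_of_eventually_eq (hc.mono fun _ h => congrArg x h)).limUnder_eq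

theorem primrec_count_true : Primrec fun w : List Bool => w.count true :=
  (Primrec.list_length.comp (Primrec.listFilter
    (Primrec.eq.comp Primrec.id (Primrec.const true)))).of_eq
    fun w => by simp [List.count_eq_length_filter]

/-- Whether the `e`-th program is seen to list a prefix of the point that `x` assigns to the number
of ones in `w`, as many steps and bits being inspected as `w` has bits. -/
def guess (x : ℕ → Cantor) (e : ℕ) (w : List Bool) : Bool :=
  decide (Listed e w.length (pre (x (w.count true)) w.length))

theorem computable_guess (hx : Computable₂ x) : Computable₂ (guess x) := by
  have hlen : Computable fun a : ℕ × List Bool => a.2.length :=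
    Computable.list_length.comp Computable.snd
  have hpre : Computable fun a : ℕ × List Bool => pre (x (a.2.count true)) a.2.length :=
    (computable_pre hx).comp (primrec_count_true.to_comp.comp Computable.snd) hlen
  exact computable_listed Computable.fst hlen hpre

theorem eventually_guess_iff (hxy : Tendsto x atTop (𝓝 y)) {e : ℕ} {r : Cantor}
    (hr : IsNameIndex e r) (hy : y ∉ frontier (openOf r)) (p : Cantor) :
    ∀ᶠ n in atTop, guess x e (pre p n) = true ↔ onesLimit x p ∈ openOf r := by
  simp only [guess, decide_eq_true_eq, length_pre]
  by_cases hp : ∃ᶠ k in atTop, p k = true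
  · rw [onesLimit_of_frequently hxy hp]
    have hlim : Tendsto (fun n => x ((pre p n).count true)) atTop (𝓝 y) :=
      hxy.comp (tendsto_count_pre hp)
    refine eventually_listed_iff hr hlim fun hmem => ?_
    have hcl : y ∉ closure (openOf r) := fun hcl =>
      hy ((isOpen_openOf r).frontier_eq ▸ ⟨hcl, hmem⟩)
    filter_upwards [hlim (isClosed_closure.isOpen_compl.mem_nhds hcl)] with n hn hmem'
    exact hn (subset_closure hmem')
  · obtain ⟨c, hc⟩ := exists_eventually_count_pre_eq (by simpa using hp)
    rw [onesLimit_of_eventually_count_eq hc]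
    have hlim : ∀ᶠ n in atTop, x ((pre p n).count true) = x c := hc.mono fun _ h => congrArg x h
    exact eventually_listed_iff hr (tendsto_nhds_of_eventually_eq hlim) fun hmem =>
      hlim.mono fun _ h => h ▸ hmem

theorem markovEffectivelyDelta2Measurable_onesLimit (hx : Computable₂ x)
    (hxy : Tendsto x atTop (𝓝 y)) (hy : IsOneGeneric y) :
    MarkovEffectivelyDelta2Measurable (onesLimit x) := by
  refine markovEffectivelyDelta2Measurable_of_eventually (computable_guess hx) ?_
  rintro e _ ⟨r, hr, rfl⟩ p
  exact eventually_guess_iff hxy hr (hy e _ ⟨r, hr, rfl⟩) p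

end OnesLimit

section Baire

theorem isGδ_setOf_frequently_eq_true : IsGδ {p : Cantor | ∃ᶠ k in atTop, p k = true} := by
  have hInter : {p : Cantor | ∃ᶠ k in atTop, p k = true} = ⋂ n, ⋃ k ≥ n, {p | p k = true} := by
    ext p
    simp [frequently_atTop]
  rw [hInter]
  exact .iInter_of_isOpen fun n => isOpen_iUnion fun k => isOpen_iUnion fun _ =>
    (isOpen_discrete {true}).preimage (continuous_apply (A := fun _ : ℕ => Bool) k)

theorem not_isGδ_onesLimit_preimage {x : ℕ → Cantor} {y : Cantor} (hxy : Tendsto x atTop (𝓝 y))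
    (hne : ∀ c, x c ≠ y) : ¬ IsGδ (onesLimit x ⁻¹' {y}ᶜ) := by
  intro hGδ
  have hdense : Dense (onesLimit x ⁻¹' {y}ᶜ) := by
    refine (dense_setOf_eventually_eq fun _ => false).mono fun p hp => ?_
    obtain ⟨c, hc⟩ := exists_eventually_count_pre_eq hp
    exact (onesLimit_of_eventually_count_eq hc).trans_ne (hne c)
  have hdense' : Dense {p : Cantor | ∃ᶠ k in atTop, p k = true} :=
    (dense_setOf_eventually_eq fun _ => true).mono fun p hp => hp.frequently
  obtain ⟨p, hp, hp'⟩ :=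
    (hdense.inter_of_Gδ hGδ isGδ_setOf_frequently_eq_true hdense').nonempty
  exact hp (onesLimit_of_frequently hxy hp')

end Baire

section Measurability

variable {f : Cantor → Cantor} {U : Set Cantor}

theorem isGδ_preimage_of_closed_cover {X Y ι : Type*} [TopologicalSpace X] [TopologicalSpace Y]
    [Countable ι] {A : ι → Set X} (hA : ∀ i, IsClosed (A i)) (hcov : ⋃ i, A i = Set.univ)
    {g : X → Y} (hg : ∀ i, ContinuousOn g (A i)) {V : Set Y} (hV : IsOpen V) :
    IsGδ (g ⁻¹' V) := by
  have hInter : g ⁻¹' V = ⋂ i, (A i ∩ g ⁻¹' Vᶜ)ᶜ := by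
    rw [← Set.compl_iUnion, ← Set.iUnion_inter, hcov, Set.univ_inter, Set.preimage_compl,
      compl_compl]
  rw [hInter]
  exact .iInter_of_isOpen fun i =>
    ((hg i).preimage_isClosed_of_isClosed (hA i) hV.isClosed_compl).isOpen_compl

theorem PiecewiseContinuous.isGδ_preimage (hf : PiecewiseContinuous f) (hU : IsOpen U) :
    IsGδ (f ⁻¹' U) :=
  let ⟨_, hA, hcov, hcont⟩ := hf
  isGδ_preimage_of_closed_cover hA hcov hcont hU

theorem EffectivelyDelta2Measurable.isGδ_preimage (hf : EffectivelyDelta2Measurable f)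
    (hU : IsOpen U) : IsGδ (f ⁻¹' U) := by
  obtain ⟨F, -, hF⟩ := hf
  obtain ⟨r, rfl⟩ := exists_openOf_eq hU
  rw [(hF r).2]
  exact .iInter_of_isOpen fun i => isOpen_openOf _

end Measurability

end Delta2

theorem corollary17_general :
    ∃ f : Delta2.Cantor → Delta2.Cantor, Delta2.MarkovEffectivelyDelta2Measurable f ∧
      ∃ U, IsOpen U ∧ ¬ IsGδ (f ⁻¹' U) := by
  obtain ⟨x, hx, y, hxy, hy⟩ := Delta2.exists_tendsto_isOneGeneric
  have hne (c : ℕ) : x c ≠ y := by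
    rintro rfl
    exact hy.not_computable (hx.comp (Computable.const c) Computable.id)
  exact ⟨Delta2.onesLimit x, Delta2.markovEffectivelyDelta2Measurable_onesLimit hx hxy hy,
    {y}ᶜ, isOpen_compl_singleton, Delta2.not_isGδ_onesLimit_preimage hxy hne⟩

theorem corollary17 :
    (∃ f : Delta2.Cantor → Delta2.Cantor,
      Delta2.MarkovEffectivelyDelta2Measurable f ∧ ¬ Delta2.PiecewiseContinuous f) ∧
    (∃ f : Delta2.Cantor → Delta2.Cantor,
      Delta2.MarkovEffectivelyDelta2Measurable f ∧ ¬ Delta2.EffectivelyDelta2Measurable f) :=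
  let ⟨f, hf, _, hU, hGδ⟩ := corollary17_general
  ⟨⟨f, hf, fun h => hGδ (h.isGδ_preimage hU)⟩, f, hf, fun h => hGδ (h.isGδ_preimage hU)⟩
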